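/- **Theorem 2.1.** Let $\gamma>0$ and $\beta\neq 0$ be real. Call $k>0$ admissible if either $\beta<0$, or $\beta>0$ and $k\neq\left(\frac{\gamma}{\beta n^2}\right)^{1/4}$ for every integer $n\ge 2$; let $K$ be the set of admissible $k$. There exist an open set $\Omega\subset\mathbb R\times K$ containing $\{0\}\times K$ and invariant under $(a,k)\mapsto(-a,k)$ (so that for each $k\in K$ it contains $(a,k)$ for all sufficiently small $|a|$), functions $w(a;k):\mathbb R\to\mathbb R$ and speeds $c(a;k)\in\mathbb R$ for $(a,k)\in\Omega$, such that: 1. For every $(a,k)\in\Omega$, $w=w(a;k)$ is $2\pi$-periodic, even and $C^\infty$, and with $c=c(a;k)$ it satisfies $$c k^2 w''+\beta k^4 w''''-k^2(w^2)''+\gamma w=0 ;$$ equivalently, $u(x,t)=w(a;k)\big(k(x-c(a;k)t)\big)$ is a traveling wave solution of the Ostrovsky equation $(u_t-\beta u_{xxx}+(u^2)_x)_x=\gamma u$. Moreover $c(-a;k)=c(a;k)$. 2. The family bifurcates from zero: $w(0;k)=0$ and $c(0;k)=c_0$ for $k\in K$, where $c_0=\frac{\gamma}{k^2}+\beta k^2$.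 3. $c$ is real-analytic in $(a,k)\in\Omega$, and $w$ depends real-analytically on $(a,k)\in\Omega$ in the sense that, for every $j\ge 0$, $(a,k)\mapsto\partial_z^j w(a;k)$ is a real-analytic map into the space of continuous $2\pi$-periodic functions with the supremum norm (equivalently, $w$ is real-analytic into $H^m(\mathbb R/2\pi\mathbb Z)$ for every $m$). 4. For each $k\in K$, as $a\to0$, $$w(a;k)(z)=a\cos z+a^2A_2\cos 2z+a^3A_3\cos 3z+a^4\left(A_{42}\cos 2z+A_{44}\cos 4z\right)+O(a^5),$$ uniformly in $z$ together with every $z$-derivative, and $$c(a;k)=c_0+a^2c_2+a^4c_4+O(a^6),$$ where $$A_2=\frac{2k^2}{3\gamma-12\beta k^4},\quad A_3=\frac{9k^2A_2}{8\gamma-72\beta k^4},\quad A_{42}=2A_2A_3-2A_2^3,\quad A_{44}=\frac{8k^2(A_2^2+2A_3)}{15\gamma-240\beta k^4},$$ $$c_2=A_2,\qquad c_4=3A_2A_3-2A_2^3 .$$ -/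

import Mathlib

open Real Filter Topology Asymptotics
open scoped ContDiff

/-- `u = u(x,t)` is a classical solution of the Ostrovsky equation
`(u_t - β u_xxx + (u²)_x)_x = γ u` on all of `ℝ × ℝ`. -/
def SolvesOstrovsky (β γ : ℝ) (u : ℝ → ℝ → ℝ) : Prop :=
  ContDiff ℝ 4 (fun p : ℝ × ℝ => u p.1 p.2) ∧
  ∀ x t : ℝ,
    deriv (fun y : ℝ =>
        deriv (fun s : ℝ => u y s) t
          - β * iteratedDeriv 3 (fun y' : ℝ => u y' t) y
          + deriv (fun y' : ℝ => u y' t ^ 2) y) x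
      = γ * u x t

/-- The profile equation `c k² w'' + β k⁴ w'''' - k² (w²)'' + γ w = 0`, pointwise on `ℝ`
(always used together with smoothness of `w`). -/
def SolvesProfile (β γ k c : ℝ) (w : ℝ → ℝ) : Prop :=
  ∀ z : ℝ,
    c * k ^ 2 * iteratedDeriv 2 w z + β * k ^ 4 * iteratedDeriv 4 w z
      - k ^ 2 * iteratedDeriv 2 (fun y : ℝ => w y ^ 2) z + γ * w z = 0

/-- The admissible wavenumbers: all `k > 0` if `β < 0`; all `k > 0` different from every resonant
value `(γ / (β n²))^(1/4)`, `n ≥ 2`, if `β > 0`. -/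
def admissibleWavenumbers (β γ : ℝ) : Set ℝ :=
  {k : ℝ | 0 < k ∧ (0 < β → ∀ n : ℕ, 2 ≤ n → k ≠ (γ / (β * (n : ℝ) ^ 2)) ^ (1 / 4 : ℝ))}

/-- The family `(a,k) ↦ w a k` of smooth `2π`-periodic functions depends real-analytically on
`(a,k) ∈ Ω`, as a map into function space: for every order `j`, the map `(a,k) ↦ ∂_z^j w(a;k)` is
real-analytic from `Ω` into the Banach space `C(ℝ/2πℤ)` with the sup norm. (Equivalently, by the
Sobolev embedding, `(a,k) ↦ w(a;k)` is real-analytic into `H^m(ℝ/2πℤ)` for every `m`.) -/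
def AnalyticProfileFamilyOn (w : ℝ → ℝ → ℝ → ℝ) (Ω : Set (ℝ × ℝ)) : Prop :=
  ∀ j : ℕ, ∃ D : ℝ × ℝ → C(AddCircle (2 * π), ℝ),
    (letI : Fact (0 < 2 * π) := ⟨Real.two_pi_pos⟩
     AnalyticOnNhd ℝ D Ω) ∧
    ∀ p ∈ Ω, ∀ z : ℝ, D p (z : AddCircle (2 * π)) = iteratedDeriv j (w p.1 p.2) z

noncomputable section

/-- Bifurcation speed `c₀`. -/
def speed0 (β γ k : ℝ) : ℝ := γ / k ^ 2 + β * k ^ 2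

def coeffA2 (β γ k : ℝ) : ℝ := 2 * k ^ 2 / (3 * γ - 12 * β * k ^ 4)

def coeffA3 (β γ k : ℝ) : ℝ := 9 * k ^ 2 * coeffA2 β γ k / (8 * γ - 72 * β * k ^ 4)

def coeffA42 (β γ k : ℝ) : ℝ := 2 * coeffA2 β γ k * coeffA3 β γ k - 2 * coeffA2 β γ k ^ 3

def coeffA44 (β γ k : ℝ) : ℝ :=
  8 * k ^ 2 * (coeffA2 β γ k ^ 2 + 2 * coeffA3 β γ k) / (15 * γ - 240 * β * k ^ 4)

def speed2 (β γ k : ℝ) : ℝ := coeffA2 β γ k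

def speed4 (β γ k : ℝ) : ℝ := 3 * coeffA2 β γ k * coeffA3 β γ k - 2 * coeffA2 β γ k ^ 3

/-- The fourth-order Stokes expansion of the profile. -/
def profileExpansion (β γ k a z : ℝ) : ℝ :=
  a * cos z + a ^ 2 * coeffA2 β γ k * cos (2 * z) + a ^ 3 * coeffA3 β γ k * cos (3 * z)
    + a ^ 4 * (coeffA42 β γ k * cos (2 * z) + coeffA44 β γ k * cos (4 * z))

/-- The expansion of the speed. -/
def speedExpansion (β γ k a : ℝ) : ℝ :=
  speed0 β γ k + a ^ 2 * speed2 β γ k + a ^ 4 * speed4 β γ k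

end

/-! Put w = a(cos z + v), where v has no mean and no cos z component, and let s be the cos z
coefficient of (cos z + v)². The cos z component of the equation forces c = c₀ + a s. For n ≥ 2 the
linear symbol at c₀ factors as (n² - 1)(β k⁴ n² - γ), so the equation becomes v = a m·(s v - (cos z
+ v)²) with the bounded Fourier multiplier m_n = k² n² / ((n² - 1)(β k⁴ n² - γ)). With the whole
multiplier μ = a m as parameter, the derivative in v at the origin is the identity. The implicit
function theorem gives one analytic branch Φ on a ball of multipliers, valid for all k at once
(`exists_solution_branch`). Pulling Φ back along (a,k) ↦ a m(k) gives the family. This map is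
analytic because admissibility means invertibility in the Banach algebra of multipliers
(`mem_admissibleWavenumbers_iff`). The weight exp n makes the coefficient space closed under
products and makes every z-derivative a bounded operator on it, so smoothness and analyticity of all
derivatives come from this single space. Translation by π together with a ↦ -a is a symmetry, so c
is even in a. The truncated expansion solves the fixed-point equation up to O(a⁴)
(`exists_stokesApprox_residual`), hence is that close to v. The prefactor a yields O(a⁵) for w and
c, and evenness improves c to O(a⁶). -/

/-! ### The space of exponentially convergent cosine series -/

noncomputable section

/-- Coefficient space of exponentially convergent cosine series: the sequence `x` stands for
`∑ x n * exp (-n) * cos (n z)`. -/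
abbrev CosineSpace : Type := lp (fun _ : ℕ => ℝ) 1

/-- Bounded Fourier multipliers. -/
abbrev Multiplier : Type := BoundedContinuousFunction ℕ ℝ

namespace CosineSpace

/-- The element standing for `cos (n z)`. -/
def mode (n : ℕ) : CosineSpace := lp.single 1 n (exp n)

lemma norm_mode (n : ℕ) : ‖mode n‖ = exp n := by
  rw [mode, lp.norm_single (by norm_num)]
  exact abs_of_pos (exp_pos _)

lemma mode_apply_self (n : ℕ) : mode n n = exp n := by
  simp [mode]

lemma mode_apply_ne {n m : ℕ} (h : m ≠ n) : mode n m = 0 := by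
  simp [mode, lp.single_apply, h]

lemma summable_abs (x : CosineSpace) : Summable fun n => |x n| := by
  simpa using (lp.memℓp x).summable (by norm_num)

lemma norm_eq_tsum (x : CosineSpace) : ‖x‖ = ∑' n, |x n| := by
  simp [lp.norm_eq_tsum_rpow (p := 1) (by norm_num) x]

variable {E : Type*} [NormedAddCommGroup E] [NormedSpace ℝ E]

-- Reduces linear and bilinear identities between cosine series to trigonometric identities on
-- single modes.
@[ext] lemma ext_mode {f g : CosineSpace →L[ℝ] E} (h : ∀ n, f (mode n) = g (mode n)) : f = g := by
  refine lp.ext_continuousLinearMap (by norm_num) fun n => ?_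
  ext
  have h1 : lp.single 1 n (1 : ℝ) = (exp n)⁻¹ • mode n := by
    rw [mode, ← lp.single_smul]
    simp [(exp_pos _).ne']
  simp [h1, h n]

lemma norm_term_le {u : ℕ → E} {C : ℝ} (hu : ∀ n, ‖u n‖ ≤ C * exp n) (x : CosineSpace) (n : ℕ) :
    ‖(x n * exp (-n)) • u n‖ ≤ |x n| * C := by
  rw [norm_smul, norm_mul, norm_eq_abs, norm_eq_abs, abs_of_pos (exp_pos _), mul_assoc]
  refine mul_le_mul_of_nonneg_left ?_ (abs_nonneg _)
  rw [exp_neg, inv_mul_le_iff₀ (exp_pos _), mul_comm]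
  exact hu n

variable [CompleteSpace E]

lemma summable_term {u : ℕ → E} {C : ℝ} (hu : ∀ n, ‖u n‖ ≤ C * exp n) (x : CosineSpace) :
    Summable fun n => (x n * exp (-n)) • u n :=
  Summable.of_norm_bounded ((summable_abs x).mul_right C) (norm_term_le hu x)

/-- The continuous linear map with prescribed values on the modes. -/
def lift (u : ℕ → E) (C : ℝ) (hu : ∀ n, ‖u n‖ ≤ C * exp n) : CosineSpace →L[ℝ] E :=
  LinearMap.mkContinuous
    { toFun := fun x => ∑' n, (x n * exp (-n)) • u n
      map_add' := fun x y => by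
        rw [← (summable_term hu x).tsum_add (summable_term hu y)]
        simp [add_mul, add_smul]
      map_smul' := fun r x => by
        rw [RingHom.id_apply, ← (summable_term hu x).tsum_const_smul]
        simp [mul_assoc, mul_smul] } C
    (fun x => by
      rw [norm_eq_tsum, mul_comm, ← tsum_mul_right]
      exact tsum_of_norm_bounded ((summable_abs x).mul_right C).hasSum (norm_term_le hu x))

lemma lift_apply {u : ℕ → E} {C : ℝ} (hu : ∀ n, ‖u n‖ ≤ C * exp n) (x : CosineSpace) :
    lift u C hu x = ∑' n, (x n * exp (-n)) • u n := rfl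

@[simp] lemma lift_mode {u : ℕ → E} {C : ℝ} (hu : ∀ n, ‖u n‖ ≤ C * exp n) (n : ℕ) :
    lift u C hu (mode n) = u n := by
  rw [lift_apply, tsum_eq_single n, mode_apply_self, ← exp_add]
  · simp
  · intro m hm
    simp [mode_apply_ne hm]

lemma norm_lift_le {u : ℕ → E} {C : ℝ} (hu : ∀ n, ‖u n‖ ≤ C * exp n) (hC : 0 ≤ C) :
    ‖lift u C hu‖ ≤ C :=
  LinearMap.mkContinuous_norm_le _ hC _

/-! ### Product, multipliers, half-period shift -/

/-- Since |n - m| ≤ n + m, the weight exp n is submultiplicative; this is what bounds the product.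
-/
lemma norm_half_add_mode_le (n m : ℕ) :
    ‖(1 / 2 : ℝ) • (mode (n + m) + mode ((n : ℤ) - m).natAbs)‖ ≤ exp n * exp m := by
  have h1 : exp (((n : ℤ) - m).natAbs : ℕ) ≤ exp n * exp m := by
    rw [← exp_add]
    refine exp_le_exp.2 ?_
    have : ((n : ℤ) - m).natAbs ≤ n + m := by omega
    exact_mod_cast this
  have h2 := norm_add_le (mode (n + m)) (mode ((n : ℤ) - m).natAbs)
  rw [norm_mode, norm_mode, Nat.cast_add, exp_add] at h2
  rw [norm_smul, norm_eq_abs, abs_of_pos (by norm_num)]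
  linarith

/-- The product of cosine series. -/
def prod : CosineSpace →L[ℝ] CosineSpace →L[ℝ] CosineSpace :=
  lift (fun n => lift (fun m => (1 / 2 : ℝ) • (mode (n + m) + mode ((n : ℤ) - m).natAbs)) (exp n)
    (norm_half_add_mode_le n)) 1
    (fun n => by rw [one_mul]; exact norm_lift_le _ (exp_pos _).le)

@[simp] lemma prod_mode (n m : ℕ) :
    prod (mode n) (mode m) = (1 / 2 : ℝ) • (mode (n + m) + mode ((n : ℤ) - m).natAbs) := by
  simp [prod]

/-- The action of bounded multipliers. -/
def diag : CosineSpace →L[ℝ] Multiplier →L[ℝ] CosineSpace :=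
  lift (E := Multiplier →L[ℝ] CosineSpace)
    (fun n => (BoundedContinuousFunction.evalCLM ℝ n).smulRight (mode n)) 1
    (fun n => by
      rw [ContinuousLinearMap.norm_smulRight_apply, norm_mode]
      refine mul_le_mul_of_nonneg_right ?_ (exp_pos _).le
      refine ContinuousLinearMap.opNorm_le_bound _ zero_le_one fun f => ?_
      rw [one_mul]
      exact f.norm_coe_le_norm n)

@[simp] lemma diag_mode (n : ℕ) (μ : Multiplier) : diag (mode n) μ = μ n • mode n := by
  simp [diag]

/-- The coordinate of index `n`. -/
def coord (n : ℕ) : CosineSpace →L[ℝ] ℝ := lp.evalCLM ℝ (fun _ : ℕ => ℝ) 1 n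

lemma coord_apply (n : ℕ) (x : CosineSpace) : coord n x = x n := rfl

lemma diag_apply (x : CosineSpace) (μ : Multiplier) (n : ℕ) : diag x μ n = μ n * x n := by
  have : coord n ∘L diag.flip μ = μ n • coord n := by
    ext m
    by_cases h : n = m
    · subst h; simp [coord_apply]
    · simp [coord_apply, mode_apply_ne h]
  simpa [coord_apply] using DFunLike.congr_fun this x

/-- The coefficient of `cos z`. -/
def firstCoeff : CosineSpace →L[ℝ] ℝ := exp (-1) • coord 1

lemma firstCoeff_apply (x : CosineSpace) : firstCoeff x = exp (-1) * x 1 := rfl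

@[simp] lemma firstCoeff_mode_one : firstCoeff (mode 1) = 1 := by
  rw [firstCoeff_apply, mode_apply_self, ← exp_add]; simp

lemma firstCoeff_mode_of_ne {n : ℕ} (h : 1 ≠ n) : firstCoeff (mode n) = 0 := by
  rw [firstCoeff_apply, mode_apply_ne h, mul_zero]

/-- The translation `z ↦ z + π`. -/
def shift : CosineSpace →L[ℝ] CosineSpace :=
  lift (fun n => (-1 : ℝ) ^ n • mode n) 1 (fun n => by simp [norm_smul, norm_mode])

@[simp] lemma shift_mode (n : ℕ) : shift (mode n) = (-1 : ℝ) ^ n • mode n := by simp [shift]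

/-- The frequencies n + m and |n - m| have equal parity, so translation by π respects products. -/
lemma neg_one_pow_natAbs_sub (n m : ℕ) :
    (-1 : ℝ) ^ ((n : ℤ) - m).natAbs = (-1) ^ n * (-1) ^ m := by
  rw [← pow_add]
  rcases Nat.even_or_odd (n + m) with h | h
  · rw [h.neg_one_pow, Even.neg_one_pow]
    grind
  · rw [h.neg_one_pow, Odd.neg_one_pow]
    grind

lemma prod_shift (x y : CosineSpace) : prod (shift x) (shift y) = shift (prod x y) := by
  have : (prod ∘L shift).bilinearComp (.id ℝ _) shift =
      (ContinuousLinearMap.compL ℝ _ _ _ shift) ∘L prod := by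
    ext n : 1
    ext m : 1
    simp [neg_one_pow_natAbs_sub, smul_smul, pow_add]
    module
  exact DFunLike.congr_fun (DFunLike.congr_fun this x) y

lemma diag_shift (x : CosineSpace) (μ : Multiplier) : diag (shift x) μ = shift (diag x μ) := by
  have : diag.flip μ ∘L shift = shift ∘L diag.flip μ := by
    ext n : 1
    simp [smul_smul, mul_comm]
  exact DFunLike.congr_fun this x

lemma firstCoeff_shift (x : CosineSpace) : firstCoeff (shift x) = -firstCoeff x := by
  have : firstCoeff ∘L shift = -firstCoeff := by
    ext n : 1
    by_cases h : 1 = n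
    · subst h; simp
    · simp [firstCoeff_mode_of_ne h]
  exact DFunLike.congr_fun this x

/-! ### Derivatives of a cosine series as continuous periodic functions -/

instance factTwoPiPos : Fact (0 < 2 * π) := ⟨two_pi_pos⟩

lemma periodic_cos_nat_mul_add (n : ℕ) (θ : ℝ) :
    Function.Periodic (fun z : ℝ => cos (n * z + θ)) (2 * π) := fun z => by
  simp only
  rw [← cos_add_nat_mul_two_pi (n * z + θ) n]
  ring_nf

/-- `∂_z ^ j cos (n z)` on the circle. -/
def circleMode (j n : ℕ) : C(AddCircle (2 * π), ℝ) where
  toFun := fun x => n ^ j * (periodic_cos_nat_mul_add n (j * (π / 2))).lift x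
  continuous_toFun := by
    refine continuous_const.mul ?_
    refine continuous_coinduced_dom.2 ?_
    change Continuous fun z : ℝ => cos (n * z + j * (π / 2))
    fun_prop

lemma circleMode_coe (j n : ℕ) (z : ℝ) :
    circleMode j n (z : AddCircle (2 * π)) = n ^ j * cos (n * z + j * (π / 2)) := rfl

/-- The exponential weight absorbs every power of n, so no derivative leaves the space. -/
lemma pow_le_factorial_mul_exp (j n : ℕ) : (n : ℝ) ^ j ≤ j.factorial * exp n := by
  have := pow_div_factorial_le_exp (n : ℝ) n.cast_nonneg j
  rwa [div_le_iff₀ (by positivity), mul_comm] at this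

lemma abs_pow_mul_cos_le (j n : ℕ) (θ : ℝ) : |(n : ℝ) ^ j * cos θ| ≤ j.factorial * exp n := by
  rw [abs_mul, abs_of_nonneg (by positivity)]
  exact (mul_le_of_le_one_right (by positivity) (abs_cos_le_one _)).trans
    (pow_le_factorial_mul_exp j n)

/-- The `j`-th derivative of a cosine series, as a continuous function on the circle. -/
def toCircleMap (j : ℕ) : CosineSpace →L[ℝ] C(AddCircle (2 * π), ℝ) :=
  lift (circleMode j) j.factorial (fun n => by
    refine (ContinuousMap.norm_le _ (by positivity)).2 fun x => ?_
    induction x using QuotientAddGroup.induction_on with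
    | H z => exact abs_pow_mul_cos_le j n _)

/-- The `j`-th derivative of a cosine series at `z`. -/
def evalDeriv (j : ℕ) (z : ℝ) : CosineSpace →L[ℝ] ℝ :=
  ContinuousMap.evalCLM ℝ (z : AddCircle (2 * π)) ∘L toCircleMap j

lemma evalDeriv_eq (j : ℕ) (z : ℝ) (x : CosineSpace) :
    evalDeriv j z x = toCircleMap j x (z : AddCircle (2 * π)) := rfl

@[simp] lemma evalDeriv_mode (j : ℕ) (z : ℝ) (n : ℕ) :
    evalDeriv j z (mode n) = n ^ j * cos (n * z + j * (π / 2)) := by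
  rw [evalDeriv_eq, toCircleMap, lift_mode, circleMode_coe]

lemma evalDeriv_eq_lift (j : ℕ) (z : ℝ) :
    evalDeriv j z = lift (fun n => (n : ℝ) ^ j * cos (n * z + j * (π / 2))) j.factorial
      (fun n => abs_pow_mul_cos_le j n _) := by
  ext n; simp

lemma hasSum_evalDeriv (j : ℕ) (z : ℝ) (x : CosineSpace) :
    HasSum (fun n => x n * exp (-n) * (n ^ j * cos (n * z + j * (π / 2)))) (evalDeriv j z x) := by
  rw [evalDeriv_eq_lift]
  exact (summable_term (fun n => abs_pow_mul_cos_le j n _) x).hasSum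

/-- Termwise differentiation, with the summable majorant |x n| (j + 1)! independent of z. -/
lemma hasDerivAt_evalDeriv (j : ℕ) (x : CosineSpace) (z : ℝ) :
    HasDerivAt (fun z => evalDeriv j z x) (evalDeriv (j + 1) z x) z := by
  have h := hasDerivAt_tsum (𝕜 := ℝ)
    (g := fun n z => x n * exp (-n) * (n ^ j * cos (n * z + j * (π / 2))))
    (g' := fun n z => x n * exp (-n) * (n ^ (j + 1) * cos (n * z + (j + 1 : ℕ) * (π / 2))))
    ((summable_abs x).mul_right ((j + 1).factorial : ℝ)) (fun n y => ?_)
    (fun n y => norm_term_le (u := fun n => (n : ℝ) ^ (j + 1) * cos (n * y + (j + 1 : ℕ) * (π / 2)))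
      (fun n => abs_pow_mul_cos_le (j + 1) n _) x n)
    (hasSum_evalDeriv j z x).summable z
  · simpa only [(hasSum_evalDeriv _ _ x).tsum_eq] using h
  · have h1 : HasDerivAt (fun z : ℝ => n * z + j * (π / 2)) (n : ℝ) y := by
      simpa using ((hasDerivAt_id y).const_mul (n : ℝ)).add_const (j * (π / 2))
    convert! (h1.cos.const_mul ((n : ℝ) ^ j)).const_mul (x n * exp (-n)) using 1
    rw [show (n : ℝ) * y + (j + 1 : ℕ) * (π / 2) = n * y + j * (π / 2) + π / 2 by push_cast; ring,
      cos_add_pi_div_two]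
    ring

lemma iteratedDeriv_evalDeriv (x : CosineSpace) (j : ℕ) :
    iteratedDeriv j (fun z => evalDeriv 0 z x) = fun z => evalDeriv j z x := by
  induction j with
  | zero => simp
  | succ j ih =>
    rw [iteratedDeriv_succ, ih]
    exact funext fun z => (hasDerivAt_evalDeriv j x z).deriv

lemma contDiff_evalDeriv (x : CosineSpace) : ContDiff ℝ ∞ fun z => evalDeriv 0 z x := by
  refine contDiff_of_differentiable_iteratedDeriv fun j _ => ?_
  rw [iteratedDeriv_evalDeriv]
  exact fun z => (hasDerivAt_evalDeriv j x z).differentiableAt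

lemma evalDeriv_add_two_pi (j : ℕ) (z : ℝ) (x : CosineSpace) :
    evalDeriv j (z + 2 * π) x = evalDeriv j z x := by
  rw [evalDeriv_eq, evalDeriv_eq, AddCircle.coe_add_period]

lemma evalDeriv_zero_neg (z : ℝ) (x : CosineSpace) : evalDeriv 0 (-z) x = evalDeriv 0 z x := by
  have : evalDeriv 0 (-z) = evalDeriv 0 z := by
    ext n; simp
  rw [this]

/-- The product-to-sum formula identifies `prod` with pointwise multiplication. -/
lemma evalDeriv_zero_prod (z : ℝ) (x y : CosineSpace) :
    evalDeriv 0 z (prod x y) = evalDeriv 0 z x * evalDeriv 0 z y := by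
  have : (ContinuousLinearMap.compL ℝ _ _ _ (evalDeriv 0 z)) ∘L prod =
      (ContinuousLinearMap.mul ℝ ℝ).bilinearComp (evalDeriv 0 z) (evalDeriv 0 z) := by
    ext n : 1
    ext m : 1
    have h1 : cos ((((n : ℤ) - m).natAbs : ℕ) * z) = cos (n * z - m * z) := by
      rw [← sub_mul, Nat.cast_natAbs]
      push_cast
      rcases abs_cases ((n : ℝ) - m) with h | h <;> rw [h.1]
      rw [neg_mul, cos_neg]
    simp only [ContinuousLinearMap.comp_apply, ContinuousLinearMap.compL_apply, prod_mode,
      map_smul, map_add, evalDeriv_mode, ContinuousLinearMap.bilinearComp_apply,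
      ContinuousLinearMap.mul_apply', pow_zero, Nat.cast_zero, zero_mul, add_zero, one_mul,
      smul_eq_mul, h1]
    rw [Nat.cast_add, add_mul, cos_add, cos_sub]
    ring
  exact DFunLike.congr_fun (DFunLike.congr_fun this x) y

end CosineSpace

end

/-! ### The reduced fixed-point equation -/

noncomputable section

namespace CosineSpace

/-- The square of the cosine series `cos z + v`. -/
def profileSq (v : CosineSpace) : CosineSpace := prod (mode 1 + v) (mode 1 + v)

/-- The nonlinearity of the reduced equation. -/
def nonlin (v : CosineSpace) : CosineSpace := firstCoeff (profileSq v) • v - profileSq v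

lemma contDiff_profileSq : ContDiff ℝ ω profileSq := by
  unfold profileSq
  fun_prop

lemma contDiff_nonlin : ContDiff ℝ ω nonlin :=
  ((firstCoeff.contDiff.comp contDiff_profileSq).smul contDiff_id).sub contDiff_profileSq

/-- Because cos(z + π) = -cos z, replacing v by `-shift v` replaces all of cos z + v by minus its
translate; squaring removes the sign. -/
lemma profileSq_reflect (v : CosineSpace) : profileSq (-shift v) = shift (profileSq v) := by
  have h : mode 1 + -shift v = -shift (mode 1 + v) := by
    rw [map_add, shift_mode]; module
  rw [profileSq, profileSq, h, map_neg, map_neg, neg_apply, neg_neg,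
    prod_shift]

lemma nonlin_reflect (v : CosineSpace) : nonlin (-shift v) = shift (nonlin v) := by
  rw [nonlin, nonlin, profileSq_reflect, firstCoeff_shift, map_sub, map_smul]
  module

/-- The defect of the fixed-point equation `v = μ · nonlin v`. -/
def defect (p : Multiplier × CosineSpace) : CosineSpace := p.2 - diag (nonlin p.2) p.1

lemma contDiff_defect : ContDiff ℝ ω defect := by
  have := contDiff_nonlin
  unfold defect
  fun_prop

/-- At μ = 0 the defect is v itself, so no linearised operator has to be inverted. -/
lemma fderiv_defect_comp_inr :
    fderiv ℝ defect 0 ∘L .inr ℝ Multiplier CosineSpace = .id ℝ CosineSpace := by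
  have h1 : HasFDerivAt defect (fderiv ℝ defect 0)
      (ContinuousLinearMap.inr ℝ Multiplier CosineSpace 0) := by
    rw [map_zero]
    exact (contDiff_defect.differentiable (by simp) 0).hasFDerivAt
  have h2 := h1.comp (0 : CosineSpace) (ContinuousLinearMap.inr ℝ Multiplier CosineSpace).hasFDerivAt
  refine h2.unique ?_
  convert! hasFDerivAt_id (𝕜 := ℝ) (0 : CosineSpace) using 1
  ext1 v
  simp [defect]

theorem exists_solution_branch :
    ∃ (Φ : Multiplier → CosineSpace) (ε : ℝ), 0 < ε ∧ Φ 0 = 0 ∧ ∀ μ, ‖μ‖ < ε →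
      AnalyticAt ℝ Φ μ ∧ Φ μ = diag (nonlin (Φ μ)) μ ∧ Φ (-μ) = -shift (Φ μ) := by
  have hc : ContDiffAt ℝ ω defect (0 : Multiplier × CosineSpace) := contDiff_defect.contDiffAt
  have hi : (fderiv ℝ defect 0 ∘L .inr ℝ Multiplier CosineSpace).IsInvertible := by
    rw [fderiv_defect_comp_inr]
    exact ⟨.refl ℝ _, rfl⟩
  have hω : (ω : WithTop ℕ∞) ≠ 0 := by simp
  set Φ := hc.implicitFunction hω hi
  have h0 : Φ 0 = 0 := hc.implicitFunction_apply_self hω hi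
  have hd0 : defect 0 = 0 := by simp [defect]
  have hΦ : ContDiffAt ℝ ω Φ 0 := hc.contDiffAt_implicitFunction hω hi
  have han : ∀ᶠ μ in 𝓝 (0 : Multiplier), AnalyticAt ℝ Φ μ := hΦ.analyticAt.eventually_analyticAt
  have heq : ∀ᶠ μ in 𝓝 (0 : Multiplier), defect (μ, Φ μ) = defect 0 :=
    hc.eventually_apply_implicitFunction hω hi
  have huniq : ∀ᶠ p in 𝓝 (0 : Multiplier × CosineSpace), defect p = defect 0 ↔ Φ p.1 = p.2 :=
    hc.eventually_apply_eq_iff_implicitFunction hω hi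
  -- For small μ the reflected pair lies in the uniqueness neighbourhood; as it also solves the
  -- equation, it must be the branch at -μ.
  have ht : Tendsto (fun μ : Multiplier => (-μ, -shift (Φ μ))) (𝓝 0) (𝓝 0) := by
    have : ContinuousAt (fun μ : Multiplier => (-μ, -shift (Φ μ))) 0 :=
      continuousAt_neg.prodMk (shift.continuous.continuousAt.comp hΦ.continuousAt).neg
    simpa only [ContinuousAt, h0, map_zero, neg_zero, Prod.mk_zero_zero] using this
  obtain ⟨ε, hε, h⟩ := Metric.eventually_nhds_iff_ball.1 (han.and (heq.and (ht.eventually huniq)))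
  refine ⟨Φ, ε, hε, h0, fun μ hμ => ?_⟩
  obtain ⟨h1, h2, h3⟩ := h μ (by simpa using hμ)
  have h4 : Φ μ = diag (nonlin (Φ μ)) μ := by
    rwa [hd0, defect, sub_eq_zero] at h2
  refine ⟨h1, h4, h3.1 ?_⟩
  rw [hd0, defect, nonlin_reflect, diag_shift, map_neg, ← h4]
  simp

end CosineSpace

/-! ### The multiplier of the linearised profile equation -/

/-- The multiplier `1 / n ^ 2` for `n ≥ 2`. -/
def invSqMultiplier : Multiplier :=
  BoundedContinuousFunction.ofNormedAddCommGroupDiscrete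
    (fun n : ℕ => if 2 ≤ n then 1 / (n : ℝ) ^ 2 else 0) 1 (fun n => by
      split_ifs with h
      · have : (2 : ℝ) ≤ n := by exact_mod_cast h
        rw [norm_eq_abs, abs_of_pos (by positivity), div_le_one (by positivity)]
        nlinarith
      · simp)

/-- The multiplier `1 / (n ^ 2 - 1)` for `n ≥ 2`. -/
def invSqSubOneMultiplier : Multiplier :=
  BoundedContinuousFunction.ofNormedAddCommGroupDiscrete
    (fun n : ℕ => if 2 ≤ n then 1 / ((n : ℝ) ^ 2 - 1) else 0) 1 (fun n => by
      split_ifs with h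
      · have : (2 : ℝ) ≤ n := by exact_mod_cast h
        rw [norm_eq_abs, abs_of_pos (one_div_pos.2 (by nlinarith)), div_le_one (by nlinarith)]
        nlinarith
      · simp)

/-- The multiplier `β k⁴ - γ / n²`, which vanishes exactly at resonances. -/
def resonanceMultiplier (β γ k : ℝ) : Multiplier :=
  (β * k ^ 4) • (1 : Multiplier) - γ • invSqMultiplier

/-- The Fourier multiplier of the reduced equation. -/
def stokesMultiplier (β γ k : ℝ) : Multiplier :=
  k ^ 2 • (invSqSubOneMultiplier * Ring.inverse (resonanceMultiplier β γ k))

lemma invSqMultiplier_apply (n : ℕ) :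
    invSqMultiplier n = if 2 ≤ n then 1 / (n : ℝ) ^ 2 else 0 := rfl

lemma invSqSubOneMultiplier_apply (n : ℕ) :
    invSqSubOneMultiplier n = if 2 ≤ n then 1 / ((n : ℝ) ^ 2 - 1) else 0 := rfl

lemma resonanceMultiplier_apply (β γ k : ℝ) (n : ℕ) :
    resonanceMultiplier β γ k n = β * k ^ 4 - γ * if 2 ≤ n then 1 / (n : ℝ) ^ 2 else 0 := by
  simp [resonanceMultiplier, invSqMultiplier_apply]

lemma contDiff_resonanceMultiplier (β γ : ℝ) : ContDiff ℝ ω (resonanceMultiplier β γ) := by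
  unfold resonanceMultiplier
  fun_prop

/-- Inversion in a Banach algebra is analytic at units, which handles all modes simultaneously. -/
lemma contDiffAt_stokesMultiplier {β γ k : ℝ} (h : IsUnit (resonanceMultiplier β γ k)) :
    ContDiffAt ℝ ω (stokesMultiplier β γ) k := by
  obtain ⟨u, hu⟩ := h
  have h1 : ContDiffAt ℝ ω (Ring.inverse : Multiplier → Multiplier) (resonanceMultiplier β γ k) :=
    hu ▸ contDiffAt_ringInverse ℝ u
  have h2 := h1.comp k (contDiff_resonanceMultiplier β γ).contDiffAt
  exact (contDiffAt_id.pow 2).smul (contDiffAt_const.mul h2)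

lemma resonanceMultiplier_ne_zero {β γ k : ℝ} (h : IsUnit (resonanceMultiplier β γ k)) (n : ℕ) :
    resonanceMultiplier β γ k n ≠ 0 := by
  intro h0
  have := DFunLike.congr_fun (Ring.mul_inverse_cancel _ h) n
  simp [h0] at this

lemma stokesMultiplier_apply {β γ k : ℝ} (h : IsUnit (resonanceMultiplier β γ k)) (n : ℕ) :
    stokesMultiplier β γ k n =
      k ^ 2 * invSqSubOneMultiplier n / resonanceMultiplier β γ k n := by
  have h1 := DFunLike.congr_fun (Ring.mul_inverse_cancel _ h) n
  rw [BoundedContinuousFunction.mul_apply, BoundedContinuousFunction.coe_one, Pi.one_apply] at h1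
  rw [eq_div_iff (resonanceMultiplier_ne_zero h n)]
  simp only [stokesMultiplier, BoundedContinuousFunction.coe_smul,
    BoundedContinuousFunction.mul_apply, smul_eq_mul]
  linear_combination k ^ 2 * invSqSubOneMultiplier n * h1

/-- Forces v to have neither mean nor cos z component, so a is exactly the cos z coefficient of w.
-/
lemma stokesMultiplier_apply_of_lt {β γ k : ℝ} (h : IsUnit (resonanceMultiplier β γ k)) {n : ℕ}
    (hn : n < 2) : stokesMultiplier β γ k n = 0 := by
  rw [stokesMultiplier_apply h, invSqSubOneMultiplier_apply, if_neg (by omega)]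
  simp

lemma nonresonant_of_isUnit {β γ k : ℝ} (h : IsUnit (resonanceMultiplier β γ k)) {n : ℕ}
    (hn : 2 ≤ n) : β * k ^ 4 * n ^ 2 - γ ≠ 0 := by
  have h1 := resonanceMultiplier_ne_zero h n
  have hn0 : (n : ℝ) ≠ 0 := by positivity
  rw [resonanceMultiplier_apply, if_pos hn] at h1
  contrapose! h1
  field_simp
  linarith

/-- `m_n (n ^ 2 - 1) (β k ^ 4 n ^ 2 - γ) = k ^ 2 n ^ 2` for the Stokes multiplier `m`. -/
lemma stokesMultiplier_mul {β γ k : ℝ} (h : IsUnit (resonanceMultiplier β γ k)) {n : ℕ}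
    (hn : 2 ≤ n) :
    stokesMultiplier β γ k n * ((n ^ 2 - 1) * (β * k ^ 4 * n ^ 2 - γ)) = k ^ 2 * n ^ 2 := by
  have h1 := nonresonant_of_isUnit h hn
  have h2 : (2 : ℝ) ≤ n := by exact_mod_cast hn
  have h3 : (n : ℝ) ^ 2 - 1 ≠ 0 := by nlinarith
  have h4 : resonanceMultiplier β γ k n = (β * k ^ 4 * n ^ 2 - γ) / n ^ 2 := by
    rw [resonanceMultiplier_apply, if_pos hn]
    field_simp
  rw [stokesMultiplier_apply h, h4, invSqSubOneMultiplier_apply, if_pos hn]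
  generalize β * k ^ 4 * (n : ℝ) ^ 2 - γ = D at h1 ⊢
  field_simp

lemma eq_rpow_iff_resonant {β γ k : ℝ} (hγ : 0 < γ) (hβ : 0 < β) (hk : 0 < k) {n : ℕ}
    (hn : 2 ≤ n) :
    k = (γ / (β * (n : ℝ) ^ 2)) ^ (1 / 4 : ℝ) ↔ β * k ^ 4 - γ * (1 / (n : ℝ) ^ 2) = 0 := by
  have hn0 : (0 : ℝ) < n := by positivity
  have hq : 0 ≤ γ / (β * (n : ℝ) ^ 2) := by positivity
  rw [one_div (4 : ℝ), Real.eq_rpow_inv hk.le hq (by norm_num)]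
  rw [show (4 : ℝ) = (4 : ℕ) by norm_num, rpow_natCast, eq_div_iff (by positivity), sub_eq_zero]
  constructor <;> intro h
  · field_simp; linarith
  · field_simp at h; linarith

/-- No small divisors: the entries tend to β k⁴ ≠ 0, so once none vanishes their reciprocals are
bounded. -/
lemma isUnit_resonanceMultiplier {β γ k : ℝ} (hβ : β ≠ 0) (hk : k ≠ 0)
    (h : ∀ n, resonanceMultiplier β γ k n ≠ 0) : IsUnit (resonanceMultiplier β γ k) := by
  have hlim : Tendsto (fun n : ℕ => resonanceMultiplier β γ k n) atTop (𝓝 (β * k ^ 4)) := by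
    have h1 : Tendsto (fun n : ℕ => β * k ^ 4 - γ * (1 / ((n : ℝ)) ^ 2)) atTop
        (𝓝 (β * k ^ 4 - γ * 0)) := by
      refine tendsto_const_nhds.sub (tendsto_const_nhds.mul ?_)
      have := tendsto_one_div_atTop_nhds_zero_nat (𝕜 := ℝ)
      simpa using this.pow 2
    rw [mul_zero, sub_zero] at h1
    refine h1.congr' ?_
    filter_upwards [eventually_ge_atTop 2] with n hn
    rw [resonanceMultiplier_apply, if_pos hn]
  obtain ⟨C, hC⟩ := (Metric.isBounded_range_of_tendsto _ (hlim.inv₀ (by positivity))).exists_norm_le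
  let g : Multiplier := BoundedContinuousFunction.ofNormedAddCommGroupDiscrete
    (fun n : ℕ => (resonanceMultiplier β γ k n)⁻¹) C (fun n => hC _ ⟨n, rfl⟩)
  refine IsUnit.of_mul_eq_one g ?_
  ext n
  exact mul_inv_cancel₀ (h n)

lemma mem_admissibleWavenumbers_iff {β γ k : ℝ} (hγ : 0 < γ) (hβ : β ≠ 0) :
    k ∈ admissibleWavenumbers β γ ↔ 0 < k ∧ IsUnit (resonanceMultiplier β γ k) := by
  refine and_congr_right fun hk => ⟨fun h => ?_, fun h hβ' n hn => ?_⟩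
  · refine isUnit_resonanceMultiplier hβ hk.ne' fun n => ?_
    rw [resonanceMultiplier_apply]
    split_ifs with hn
    · rcases hβ.lt_or_gt with hneg | hpos
      · have h1 : 0 < k ^ 4 := by positivity
        have h2 : 0 < 1 / (n : ℝ) ^ 2 := by positivity
        nlinarith
      · rw [Ne, ← eq_rpow_iff_resonant hγ hpos hk hn]
        exact h hpos n hn
    · rw [mul_zero, sub_zero]
      positivity
  · rw [Ne, eq_rpow_iff_resonant hγ hβ' hk hn]
    have := resonanceMultiplier_ne_zero h n
    rwa [resonanceMultiplier_apply, if_pos hn] at this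

/-- This set serves as Ω; it is open because the units of a Banach algebra are. -/
lemma isOpen_admissible_ball (β γ ε : ℝ) :
    IsOpen {p : ℝ × ℝ | (0 < p.2 ∧ IsUnit (resonanceMultiplier β γ p.2)) ∧
      ‖p.1 • stokesMultiplier β γ p.2‖ < ε} := by
  have h1 : IsOpen {p : ℝ × ℝ | 0 < p.2 ∧ IsUnit (resonanceMultiplier β γ p.2)} :=
    (isOpen_lt continuous_const continuous_snd).inter
      (Units.isOpen.preimage ((contDiff_resonanceMultiplier β γ).continuous.comp continuous_snd))
  refine ContinuousOn.isOpen_inter_preimage (s := {p : ℝ × ℝ | 0 < p.2 ∧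
    IsUnit (resonanceMultiplier β γ p.2)}) (t := Set.Iio ε) ?_ h1 isOpen_Iio
  refine ContinuousOn.norm (continuousOn_fst.smul fun p hp => ?_)
  exact ((contDiffAt_stokesMultiplier hp.2).continuousAt.comp
    continuousAt_snd).continuousWithinAt

end

/-! ### The profile equation and the Ostrovsky equation -/

lemma iteratedDeriv_comp_mul_sub {f : ℝ → ℝ} (hf : ContDiff ℝ ∞ f) (k s : ℝ) (n : ℕ) :
    iteratedDeriv n (fun y => f (k * (y - s))) =
      fun y => k ^ n * iteratedDeriv n f (k * (y - s)) := by
  induction n with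
  | zero => simp
  | succ n ih =>
    rw [iteratedDeriv_succ, ih]
    funext y
    have h1 : HasDerivAt (fun y => k * (y - s)) k y := by
      simpa using ((hasDerivAt_id y).sub_const s).const_mul k
    have h2 : HasDerivAt (iteratedDeriv n f) (iteratedDeriv (n + 1) f (k * (y - s)))
        (k * (y - s)) := by
      rw [iteratedDeriv_succ]
      exact (hf.differentiable_iteratedDeriv n (by exact_mod_cast WithTop.coe_lt_top _)
        _).hasDerivAt
    refine ((h2.comp y h1).const_mul (k ^ n)).deriv.trans ?_
    ring

lemma SolvesProfile.solvesOstrovsky {β γ k c : ℝ} {w : ℝ → ℝ} (hw : ContDiff ℝ ∞ w)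
    (h : SolvesProfile β γ k c w) : SolvesOstrovsky β γ (fun x t => w (k * (x - c * t))) := by
  refine ⟨(contDiff_infty.1 hw 4).comp (by fun_prop), fun x t => ?_⟩
  have hd : ∀ {f : ℝ → ℝ}, ContDiff ℝ ∞ f → ∀ n z,
      HasDerivAt (iteratedDeriv n f) (iteratedDeriv (n + 1) f z) z := fun {f} hf n z => by
    rw [iteratedDeriv_succ]
    exact (hf.differentiable_iteratedDeriv n (by exact_mod_cast WithTop.coe_lt_top _)
      z).hasDerivAt
  have hw2 : ContDiff ℝ ∞ fun z => w z ^ 2 := hw.pow 2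
  have h1 : ∀ y, deriv (fun s => w (k * (y - c * s))) t =
      -(k * c) * iteratedDeriv 1 w (k * (y - c * t)) := fun y => by
    have h1 : HasDerivAt (fun s => k * (y - c * s)) (-(k * c)) t := by
      convert! (((hasDerivAt_id t).const_mul c).const_sub y).const_mul k using 1
      ring
    have h2 := hd hw 0 (k * (y - c * t))
    rw [iteratedDeriv_zero] at h2
    refine (h2.comp t h1).deriv.trans ?_
    ring
  have h2 : ∀ y, deriv (fun y => w (k * (y - c * t)) ^ 2) y =
      k * iteratedDeriv 1 (fun z => w z ^ 2) (k * (y - c * t)) := fun y => by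
    have := congrFun (iteratedDeriv_comp_mul_sub hw2 k (c * t) 1) y
    rwa [iteratedDeriv_one, pow_one] at this
  simp only [h1, h2, iteratedDeriv_comp_mul_sub hw]
  have h3 : HasDerivAt (fun y => k * (y - c * t)) k x := by
    simpa using ((hasDerivAt_id x).sub_const (c * t)).const_mul k
  have h4 := ((((hd hw 1 (k * (x - c * t))).comp x h3).const_mul (-(k * c))).sub
    ((((hd hw 3 (k * (x - c * t))).comp x h3).const_mul (k ^ 3)).const_mul β)).add
    (((hd hw2 1 (k * (x - c * t))).comp x h3).const_mul k)
  refine (h4.deriv).trans ?_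
  -- The Ostrovsky residual along the travelling wave is minus the profile equation.
  linear_combination -h (k * (x - c * t))

noncomputable section

namespace CosineSpace

/-- The speed associated with amplitude `a` and reduced profile `v`. -/
def waveSpeed (β γ a k : ℝ) (v : CosineSpace) : ℝ := speed0 β γ k + a * firstCoeff (profileSq v)

/-- Comparison of cosine coefficients, applied with p = c k², q = β k⁴, r = k², s = γ, x = w and y =
w². -/
lemma evalDeriv_profile_eq_zero {p q r s z : ℝ} {x y : CosineSpace}
    (h : ∀ n : ℕ, (-p * n ^ 2 + q * n ^ 4 + s) * x n + r * n ^ 2 * y n = 0) :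
    p * evalDeriv 2 z x + q * evalDeriv 4 z x - r * evalDeriv 2 z y + s * evalDeriv 0 z x = 0 := by
  have h1 := ((((hasSum_evalDeriv 2 z x).mul_left p).add ((hasSum_evalDeriv 4 z x).mul_left q)).sub
    ((hasSum_evalDeriv 2 z y).mul_left r)).add ((hasSum_evalDeriv 0 z x).mul_left s)
  refine h1.unique ?_
  convert! hasSum_zero using 1
  funext n
  have h2 : cos (n * z + (2 : ℕ) * (π / 2)) = -cos (n * z) := by
    rw [← cos_add_pi]; push_cast; ring_nf
  have h4 : cos (n * z + (4 : ℕ) * (π / 2)) = cos (n * z) := by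
    rw [← cos_add_two_pi (n * z)]; push_cast; ring_nf
  have h0 : cos (n * z + (0 : ℕ) * (π / 2)) = cos (n * z) := by simp
  rw [h0, h2, h4]
  linear_combination exp (-n) * cos (n * z) * h n

lemma evalDeriv_zero_sq (z : ℝ) (x : CosineSpace) :
    evalDeriv 0 z x ^ 2 = evalDeriv 0 z (prod x x) := by
  rw [evalDeriv_zero_prod, sq]

lemma solvesProfile_of_fixedPoint {β γ k a : ℝ} {v : CosineSpace} (hk : 0 < k)
    (hu : IsUnit (resonanceMultiplier β γ k))
    (hv : v = diag (nonlin v) (a • stokesMultiplier β γ k)) :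
    SolvesProfile β γ k (waveSpeed β γ a k v) (fun z => evalDeriv 0 z (a • (mode 1 + v))) := by
  intro z
  simp only [evalDeriv_zero_sq, iteratedDeriv_evalDeriv]
  refine evalDeriv_profile_eq_zero fun n => ?_
  have hvn : v n = a * stokesMultiplier β γ k n *
      (firstCoeff (profileSq v) * v n - profileSq v n) := by
    conv_lhs => rw [hv, diag_apply]
    rfl
  have hx : (a • (mode 1 + v)) n = a * (mode 1 n + v n) := rfl
  have hy : (prod (a • (mode 1 + v)) (a • (mode 1 + v))) n = a ^ 2 * profileSq v n := by
    rw [map_smul, map_smul, smul_apply, smul_smul, ← sq]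
    rfl
  have hc : k ^ 2 * waveSpeed β γ a k v = γ + β * k ^ 4 + k ^ 2 * a * firstCoeff (profileSq v) := by
    rw [waveSpeed, speed0]
    field_simp
  rw [hx, hy]
  obtain hn | hn | hn : n = 0 ∨ n = 1 ∨ 2 ≤ n := by omega
  · subst hn
    rw [stokesMultiplier_apply_of_lt hu (by norm_num)] at hvn
    rw [hvn, mode_apply_ne (by norm_num)]
    simp
  · subst hn
    rw [stokesMultiplier_apply_of_lt hu (by norm_num)] at hvn
    -- The cos z balance is precisely the definition of `waveSpeed`.
    have h1 : profileSq v 1 = exp 1 * firstCoeff (profileSq v) := by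
      rw [firstCoeff_apply, ← mul_assoc, ← exp_add]
      simp
    have h2 : v 1 = 0 := by rw [hvn]; ring
    rw [h2, h1, mode_apply_self]
    push_cast
    linear_combination -a * exp 1 * hc
  · rw [mode_apply_ne (by omega)]
    have hm := stokesMultiplier_mul hu hn
    linear_combination -a * n ^ 2 * v n * hc +
      a * (((n : ℝ) ^ 2 - 1) * (β * k ^ 4 * n ^ 2 - γ)) * hvn +
      a ^ 2 * (firstCoeff (profileSq v) * v n - profileSq v n) * hm

end CosineSpace

end

/-! ### The Stokes expansion -/

/-- An even analytic function which is `O(a ^ n)` with `n` odd is `O(a ^ (n + 1))`. -/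
lemma AnalyticAt.isBigO_pow_succ_of_even {f : ℝ → ℝ} (hf : AnalyticAt ℝ f 0)
    (heven : ∀ᶠ a in 𝓝 0, f (-a) = f a) {n : ℕ} (hn : Odd n)
    (hO : f =O[𝓝 0] fun a => a ^ n) : f =O[𝓝 0] fun a => a ^ (n + 1) := by
  obtain ⟨g, hg, hfg⟩ : ∃ g, AnalyticAt ℝ g 0 ∧ ∀ᶠ z in 𝓝 0, f z = (z - 0) ^ (n + 1) • g z := by
    rw [← natCast_le_analyticOrderAt hf]
    by_contra! hlt
    obtain ⟨m, hm⟩ := ENat.ne_top_iff_exists.1 hlt.ne_top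
    rw [← hm] at hlt
    have hmn : m < n + 1 := by exact_mod_cast hlt
    obtain ⟨g, hg, hg0, hfg⟩ := hf.analyticOrderAt_eq_natCast.1 hm.symm
    simp only [sub_zero, smul_eq_mul] at hfg
    have hgc : Tendsto g (𝓝[≠] 0) (𝓝 (g 0)) := hg.continuousAt.tendsto.mono_left nhdsWithin_le_nhds
    -- If the vanishing order m is below n, the bound O(aⁿ) forces g 0 = 0; if m = n is odd,
    -- evenness makes g odd, with the same contradiction.
    rcases (Nat.lt_succ_iff.1 hmn).lt_or_eq with h | rfl
    · obtain ⟨C, hC⟩ := hO.bound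
      have h1 : Tendsto (fun a : ℝ => C * |a|) (𝓝[≠] 0) (𝓝 0) := by
        have : Continuous fun a : ℝ => C * |a| := by fun_prop
        simpa using (this.tendsto 0).mono_left nhdsWithin_le_nhds
      refine hg0 (abs_eq_zero.1 (le_antisymm (le_of_tendsto_of_tendsto hgc.abs h1 ?_)
        (abs_nonneg _)))
      have hsmall : ∀ᶠ a : ℝ in 𝓝 0, |a| < 1 := by
        have : Continuous fun a : ℝ => |a| := by fun_prop
        exact (this.tendsto 0).eventually_lt_const (by simp)
      filter_upwards [nhdsWithin_le_nhds hC, nhdsWithin_le_nhds hfg, nhdsWithin_le_nhds hsmall,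
        self_mem_nhdsWithin] with a h2 h3 h4 h5
      rw [h3, norm_eq_abs, norm_eq_abs, abs_mul, abs_pow, abs_pow] at h2
      have ha : 0 < |a| := abs_pos.2 h5
      obtain ⟨d, rfl⟩ : ∃ d, n = m + 1 + d := ⟨n - (m + 1), by omega⟩
      have hCn : 0 ≤ C := by
        by_contra! hneg
        have : C * |a| ^ (m + 1 + d) < 0 := mul_neg_of_neg_of_pos hneg (by positivity)
        have : 0 ≤ |a| ^ m * |g a| := by positivity
        linarith
      have h6 : |a| ^ m * |g a| ≤ |a| ^ m * (C * |a|) := by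
        refine h2.trans ?_
        have : |a| ^ d ≤ 1 := pow_le_one₀ ha.le h4.le
        calc C * |a| ^ (m + 1 + d) = |a| ^ m * (C * |a|) * |a| ^ d := by ring
          _ ≤ |a| ^ m * (C * |a|) * 1 := by gcongr
          _ = _ := mul_one _
      exact le_of_mul_le_mul_left h6 (by positivity)
    · have hneg : Tendsto (fun a : ℝ => -a) (𝓝[≠] 0) (𝓝 0) := by
        have : Continuous fun a : ℝ => -a := by fun_prop
        simpa using (this.tendsto 0).mono_left nhdsWithin_le_nhds
      have h1 : Tendsto (fun a => -g (-a)) (𝓝[≠] 0) (𝓝 (-g 0)) :=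
        (hg.continuousAt.tendsto.comp hneg).neg
      have h2 : g =ᶠ[𝓝[≠] 0] fun a => -g (-a) := by
        filter_upwards [nhdsWithin_le_nhds hfg, hneg.eventually hfg, nhdsWithin_le_nhds heven,
          self_mem_nhdsWithin] with a h3 h4 h5 h6
        rw [h5, h3, hn.neg_pow] at h4
        refine mul_left_cancel₀ (pow_ne_zero m h6) ?_
        linarith
      have := tendsto_nhds_unique (hgc.congr' h2) h1
      exact hg0 (by linarith)
  have h1 : (fun a => a ^ (n + 1) * g a) =O[𝓝 0] fun a : ℝ => a ^ (n + 1) * 1 :=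
    (isBigO_refl _ _).mul (hg.continuousAt.tendsto.isBigO_one ℝ)
  simp only [mul_one] at h1
  refine h1.congr' ?_ EventuallyEq.rfl
  filter_upwards [hfg] with a ha
  rw [ha, sub_zero, smul_eq_mul]

noncomputable section

/-- This and the next three identities turn the closed forms into the recursion obtained by matching
powers of a in the fixed-point equation. -/
lemma coeffA2_eq {β γ k : ℝ} (h : IsUnit (resonanceMultiplier β γ k)) :
    coeffA2 β γ k = -(stokesMultiplier β γ k 2 / 2) := by
  have h1 := stokesMultiplier_mul h le_rfl
  have h2 := nonresonant_of_isUnit h le_rfl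
  push_cast at h1 h2
  have h3 : 3 * γ - 12 * β * k ^ 4 ≠ 0 := fun h0 => h2 (by linarith)
  rw [coeffA2, div_eq_iff h3]
  linear_combination -h1 / 2

lemma coeffA3_eq {β γ k : ℝ} (h : IsUnit (resonanceMultiplier β γ k)) :
    coeffA3 β γ k = -(stokesMultiplier β γ k 3 * coeffA2 β γ k) := by
  have h1 := stokesMultiplier_mul h (show 2 ≤ 3 by norm_num)
  have h2 := nonresonant_of_isUnit h (show 2 ≤ 3 by norm_num)
  push_cast at h1 h2
  have h3 : 8 * γ - 72 * β * k ^ 4 ≠ 0 := fun h0 => h2 (by linarith)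
  rw [coeffA3, div_eq_iff h3]
  linear_combination -coeffA2 β γ k * h1

lemma coeffA42_eq {β γ k : ℝ} (h : IsUnit (resonanceMultiplier β γ k)) :
    coeffA42 β γ k = stokesMultiplier β γ k 2 * (coeffA2 β γ k ^ 2 - coeffA3 β γ k) := by
  rw [coeffA42]
  linear_combination
    (2 * coeffA3 β γ k - 2 * coeffA2 β γ k ^ 2) * coeffA2_eq h

lemma coeffA44_eq {β γ k : ℝ} (h : IsUnit (resonanceMultiplier β γ k)) :
    coeffA44 β γ k =
      -(stokesMultiplier β γ k 4 * (coeffA2 β γ k ^ 2 / 2 + coeffA3 β γ k)) := by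
  have h1 := stokesMultiplier_mul h (show 2 ≤ 4 by norm_num)
  have h2 := nonresonant_of_isUnit h (show 2 ≤ 4 by norm_num)
  push_cast at h1 h2
  have h3 : 15 * γ - 240 * β * k ^ 4 ≠ 0 := fun h0 => h2 (by linarith)
  rw [coeffA44, div_eq_iff h3]
  linear_combination -(coeffA2 β γ k ^ 2 / 2 + coeffA3 β γ k) * h1

namespace CosineSpace

/-- The truncated Stokes expansion in coefficient space, without its leading factor `a`. -/
def stokesApprox (β γ k a : ℝ) : CosineSpace :=
  (a * coeffA2 β γ k + a ^ 3 * coeffA42 β γ k) • mode 2 + (a ^ 2 * coeffA3 β γ k) • mode 3 +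
    (a ^ 3 * coeffA44 β γ k) • mode 4

lemma continuous_stokesApprox (β γ k : ℝ) : Continuous (stokesApprox β γ k) := by
  unfold stokesApprox
  fun_prop

lemma evalDeriv_stokesApprox (β γ k a z : ℝ) :
    evalDeriv 0 z (a • (mode 1 + stokesApprox β γ k a)) = profileExpansion β γ k a z := by
  simp [stokesApprox, profileExpansion]
  ring

lemma profileSq_modes (p q r : ℝ) :
    profileSq (p • mode 2 + q • mode 3 + r • mode 4) =
      ((1 + p ^ 2 + q ^ 2 + r ^ 2) / 2) • mode 0 + (p + p * q + q * r) • mode 1 +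
      (1 / 2 + q + p * r) • mode 2 + (p + r) • mode 3 + (p ^ 2 / 2 + q) • mode 4 +
      (r + p * q) • mode 5 + (p * r + q ^ 2 / 2) • mode 6 + (q * r) • mode 7 +
      (r ^ 2 / 2) • mode 8 := by
  simp only [profileSq, map_add, map_smul, add_apply, smul_apply, prod_mode]
  norm_num
  module

lemma firstCoeff_profileSq_modes (p q r : ℝ) :
    firstCoeff (profileSq (p • mode 2 + q • mode 3 + r • mode 4)) = p + p * q + q * r := by
  simp [profileSq_modes, firstCoeff_mode_of_ne]

/-- The truncated Stokes expansion solves the fixed-point equation up to `O(a ^ 4)`. -/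
lemma exists_stokesApprox_residual {β γ k : ℝ} (h : IsUnit (resonanceMultiplier β γ k)) :
    ∃ r : ℝ → CosineSpace, Continuous r ∧ ∀ a,
      stokesApprox β γ k a = diag (nonlin (stokesApprox β γ k a)) (a • stokesMultiplier β γ k) +
        a ^ 4 • r a := by
  have e0 := stokesMultiplier_apply_of_lt h (n := 0) (by norm_num)
  have e1 := stokesMultiplier_apply_of_lt h (n := 1) (by norm_num)
  have e2 := coeffA2_eq h
  have e3 := coeffA3_eq h
  have e42 := coeffA42_eq h
  have e44 := coeffA44_eq h
  simp only [stokesApprox, nonlin, firstCoeff_profileSq_modes]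
  simp only [profileSq_modes]
  generalize coeffA2 β γ k = A at *
  generalize coeffA3 β γ k = D at *
  generalize coeffA42 β γ k = B at *
  generalize coeffA44 β γ k = C at *
  generalize stokesMultiplier β γ k = m at *
  -- The witness is what remains, mode by mode, after dividing the terms of order a⁴ and higher by
  -- a⁴.
  refine ⟨fun a =>
    (a * m 2 * ((A + a ^ 2 * B) * C - (B + (A + a ^ 2 * B) * D + a ^ 2 * D * C) *
      (A + a ^ 2 * B) - A * B)) • mode 2 +
    (m 3 * (B + C - (A + a ^ 2 * (B + (A + a ^ 2 * B) * D + a ^ 2 * D * C)) * D)) • mode 3 +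
    (a * m 4 * (-((A + a ^ 2 * (B + (A + a ^ 2 * B) * D + a ^ 2 * D * C)) * C) + A * B +
      a ^ 2 * B ^ 2 / 2)) • mode 4 +
    (m 5 * (C + (A + a ^ 2 * B) * D)) • mode 5 +
    (a * m 6 * ((A + a ^ 2 * B) * C + D ^ 2 / 2)) • mode 6 +
    (a ^ 2 * m 7 * (D * C)) • mode 7 + (a ^ 3 * m 8 * (C ^ 2 / 2)) • mode 8, by fun_prop,
    fun a => ?_⟩
  simp only [map_add, map_sub, map_smul, add_apply, sub_apply, smul_apply, diag_mode, e0, e1]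
  match_scalars
  · linear_combination a * e2 + a ^ 3 * e42
  · linear_combination a ^ 2 * e3
  · linear_combination a ^ 3 * e44
  all_goals ring

/-- For small a the fixed-point map has Lipschitz constant at most 1/2 near 0, so the error is at
most twice the residual. -/
lemma isBigO_sub_stokesApprox {β γ k : ℝ} (h : IsUnit (resonanceMultiplier β γ k))
    {V : ℝ → CosineSpace} (hV : ContinuousAt V 0) (hV0 : V 0 = 0)
    (hfix : ∀ᶠ a in 𝓝 0, V a = diag (nonlin (V a)) (a • stokesMultiplier β γ k)) :
    (fun a => V a - stokesApprox β γ k a) =O[𝓝 0] fun a : ℝ => a ^ 4 := by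
  obtain ⟨r, hr, hres⟩ := exists_stokesApprox_residual h
  obtain ⟨K, t, ht, hK⟩ := ((contDiff_nonlin.of_le le_top).contDiffAt
    (x := (0 : CosineSpace))).exists_lipschitzOnWith
  have hA : Tendsto (stokesApprox β γ k) (𝓝 0) (𝓝 0) := by
    simpa [stokesApprox] using (continuous_stokesApprox β γ k).tendsto 0
  have hVt : Tendsto V (𝓝 0) (𝓝 0) := hV0 ▸ hV.tendsto
  set m := stokesMultiplier β γ k
  let T : CosineSpace →L[ℝ] CosineSpace := diag.flip m
  have hT : ∀ (x : CosineSpace) (a : ℝ), diag x (a • m) = a • T x := fun x a => by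
    rw [map_smul]; rfl
  have hsmall : ∀ᶠ a : ℝ in 𝓝 0, |a| * (‖T‖ * K) < 1 / 2 := by
    have : Continuous fun a : ℝ => |a| * (‖T‖ * K) := by fun_prop
    exact (this.tendsto 0).eventually_lt_const (by simp)
  have hr1 : ∀ᶠ a in 𝓝 0, ‖r a‖ < ‖r 0‖ + 1 :=
    (hr.norm.tendsto 0).eventually_lt_const (by linarith)
  refine IsBigO.of_bound (2 * (‖r 0‖ + 1)) ?_
  filter_upwards [hfix, hVt ht, hA ht, hsmall, hr1] with a h1 h2 h3 h4 h5
  have h6 : V a - stokesApprox β γ k a =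
      diag (nonlin (V a) - nonlin (stokesApprox β γ k a)) (a • m) - a ^ 4 • r a := by
    rw [map_sub, sub_apply, ← h1]
    nth_rewrite 1 [hres a]
    abel
  have h7 : ‖diag (nonlin (V a) - nonlin (stokesApprox β γ k a)) (a • m)‖ ≤
      |a| * (‖T‖ * K) * ‖V a - stokesApprox β γ k a‖ := by
    rw [hT, norm_smul, norm_eq_abs]
    have h8 := hK.norm_sub_le h2 h3
    calc _ ≤ |a| * (‖T‖ * (K * ‖V a - stokesApprox β γ k a‖)) := by
          gcongr
          exact T.le_opNorm_of_le h8
      _ = _ := by ring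
  have h8 := norm_sub_le (diag (nonlin (V a) - nonlin (stokesApprox β γ k a)) (a • m))
    (a ^ 4 • r a)
  rw [← h6, norm_smul] at h8
  have h9 : ‖a ^ 4‖ * ‖r a‖ ≤ ‖a ^ 4‖ * (‖r 0‖ + 1) := by gcongr
  have h10 : |a| * (‖T‖ * K) * ‖V a - stokesApprox β γ k a‖ ≤
      1 / 2 * ‖V a - stokesApprox β γ k a‖ := by gcongr
  linarith

lemma abs_evalDeriv_le (j : ℕ) (z : ℝ) (x : CosineSpace) :
    |evalDeriv j z x| ≤ ‖toCircleMap j‖ * ‖x‖ :=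
  ((toCircleMap j x).norm_coe_le_norm _).trans ((toCircleMap j).le_opNorm x)

lemma isBigO_waveSpeed_sub {β γ k : ℝ} {V : ℝ → CosineSpace} (hV : ContinuousAt V 0)
    (hV0 : V 0 = 0)
    (hO : (fun a => V a - stokesApprox β γ k a) =O[𝓝 0] fun a : ℝ => a ^ 4) :
    (fun a => waveSpeed β γ a k (V a) - speedExpansion β γ k a) =O[𝓝 0] fun a : ℝ => a ^ 5 := by
  have hf : ContDiff ℝ ω fun v => firstCoeff (profileSq v) :=
    firstCoeff.contDiff.comp contDiff_profileSq
  obtain ⟨K, t, ht, hK⟩ := ((hf.of_le le_top).contDiffAt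
    (x := (0 : CosineSpace))).exists_lipschitzOnWith
  have hA : Tendsto (stokesApprox β γ k) (𝓝 0) (𝓝 0) := by
    simpa [stokesApprox] using (continuous_stokesApprox β γ k).tendsto 0
  have hVt : Tendsto V (𝓝 0) (𝓝 0) := hV0 ▸ hV.tendsto
  have h1 : (fun a => firstCoeff (profileSq (V a)) - firstCoeff (profileSq (stokesApprox β γ k a)))
      =O[𝓝 0] fun a : ℝ => a ^ 4 := by
    refine IsBigO.trans (IsBigO.of_bound K ?_) hO
    filter_upwards [hVt ht, hA ht] with a h2 h3
    exact hK.norm_sub_le h2 h3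
  have h2 := (isBigO_refl (fun a : ℝ => a) (𝓝 0)).mul h1
  -- The only term of the truncated profile's speed beyond `speedExpansion`; the a⁴ terms match
  -- since c₄ = A₄₂ + A₂A₃.
  have h3 : (fun a : ℝ => a ^ 6 *
      (coeffA42 β γ k * coeffA3 β γ k + coeffA3 β γ k * coeffA44 β γ k)) =O[𝓝 0]
      fun a : ℝ => a ^ 5 := by
    simpa [mul_comm] using (isBigO_const_mul_self
      (coeffA42 β γ k * coeffA3 β γ k + coeffA3 β γ k * coeffA44 β γ k) (fun a : ℝ => a ^ 6)
      (𝓝 0)).trans (isLittleO_pow_pow (show 5 < 6 by norm_num)).isBigO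
  have h4 : (fun a : ℝ => a * a ^ 4) = fun a => a ^ 5 := by
    funext a; ring
  rw [h4] at h2
  refine (h2.add h3).congr_left fun a => ?_
  rw [waveSpeed, speedExpansion, speed2, speed4, stokesApprox, firstCoeff_profileSq_modes,
    coeffA42]
  ring

end CosineSpace

end

/-! ### The bifurcating family -/

theorem theorem2p1 (β γ : ℝ) (hγ : 0 < γ) (hβ : β ≠ 0) :
    ∃ (Ω : Set (ℝ × ℝ)) (w : ℝ → ℝ → ℝ → ℝ) (c : ℝ → ℝ → ℝ),
      -- the parameter domain: an open neighbourhood of `{0} × K`, symmetric in `a`,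
      -- where `K` is the set of admissible wavenumbers
      IsOpen Ω ∧
      (∀ k ∈ admissibleWavenumbers β γ, ((0 : ℝ), k) ∈ Ω) ∧
      (∀ a k : ℝ, (a, k) ∈ Ω → k ∈ admissibleWavenumbers β γ ∧ (-a, k) ∈ Ω) ∧
      -- the solutions
      (∀ a k : ℝ, (a, k) ∈ Ω →
        ContDiff ℝ ∞ (w a k) ∧
        Function.Periodic (w a k) (2 * π) ∧
        Function.Even (w a k) ∧
        SolvesProfile β γ k (c a k) (w a k) ∧
        SolvesOstrovsky β γ (fun x t : ℝ => w a k (k * (x - c a k * t))) ∧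
        c (-a) k = c a k) ∧
      -- bifurcation from the zero solution at the speed `c₀`
      (∀ k ∈ admissibleWavenumbers β γ, (∀ z : ℝ, w 0 k z = 0) ∧ c 0 k = speed0 β γ k) ∧
      -- joint analyticity in `(a, k)`
      AnalyticProfileFamilyOn w Ω ∧
      AnalyticOnNhd ℝ (fun p : ℝ × ℝ => c p.1 p.2) Ω ∧
      -- expansions as `a → 0`; that of `w` is uniform in `z`, together with all `z`-derivatives
      (∀ k ∈ admissibleWavenumbers β γ,
        (∀ j : ℕ, ∃ C : ℝ, ∀ᶠ a in 𝓝 (0 : ℝ), ∀ z : ℝ,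
          |iteratedDeriv j (fun y : ℝ => w a k y - profileExpansion β γ k a y) z| ≤ C * |a| ^ 5) ∧
        (fun a : ℝ => c a k - speedExpansion β γ k a) =O[𝓝 0] (fun a : ℝ => a ^ 6)) := by
  obtain ⟨Φ, ε, hε, hΦ0, hΦ⟩ := CosineSpace.exists_solution_branch
  set m := stokesMultiplier β γ
  set V : ℝ × ℝ → CosineSpace := fun p => Φ (p.1 • m p.2) with hVdef
  set Ω : Set (ℝ × ℝ) := {p | (0 < p.2 ∧ IsUnit (resonanceMultiplier β γ p.2)) ∧
    ‖p.1 • m p.2‖ < ε}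
  have hK : ∀ k, k ∈ admissibleWavenumbers β γ ↔ 0 < k ∧ IsUnit (resonanceMultiplier β γ k) :=
    fun k => mem_admissibleWavenumbers_iff hγ hβ
  have hopen : IsOpen Ω := isOpen_admissible_ball β γ ε
  have hzero : ∀ k ∈ admissibleWavenumbers β γ, ((0 : ℝ), k) ∈ Ω := fun k hk =>
    ⟨(hK k).1 hk, by simpa using hε⟩
  have hV0 : ∀ k, V (0, k) = 0 := fun k => by simp [hVdef, hΦ0]
  have hVan : AnalyticOnNhd ℝ V Ω := fun p hp => by
    have h1 : ContDiffAt ℝ ω (fun p : ℝ × ℝ => p.1 • m p.2) p :=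
      contDiffAt_fst.smul ((contDiffAt_stokesMultiplier hp.1.2).comp p contDiffAt_snd)
    exact AnalyticAt.comp (g := Φ) (f := fun p : ℝ × ℝ => p.1 • m p.2) (hΦ _ hp.2).1 h1.analyticAt
  have hVfix : ∀ p ∈ Ω, V p = CosineSpace.diag (CosineSpace.nonlin (V p)) (p.1 • m p.2) :=
    fun p hp => (hΦ _ hp.2).2.1
  have hneg : ∀ a k : ℝ, (-a) • m k = -(a • m k) := fun a k => neg_smul a (m k)
  have hVneg : ∀ a k : ℝ, (a, k) ∈ Ω → V (-a, k) = -CosineSpace.shift (V (a, k)) :=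
    fun a k hp => by
      simp only [hVdef]
      rw [hneg]
      exact (hΦ _ hp.2).2.2
  have hcneg : ∀ a k : ℝ, (a, k) ∈ Ω → CosineSpace.waveSpeed β γ (-a) k (V (-a, k)) =
      CosineSpace.waveSpeed β γ a k (V (a, k)) := fun a k hp => by
    rw [hVneg a k hp, CosineSpace.waveSpeed, CosineSpace.waveSpeed, CosineSpace.profileSq_reflect,
      CosineSpace.firstCoeff_shift, neg_mul_neg]
  have hcan : AnalyticOnNhd ℝ (fun p : ℝ × ℝ => CosineSpace.waveSpeed β γ p.1 p.2 (V p)) Ω :=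
    fun p hp => by
      have h1 : ContDiffAt ℝ ω (fun p => CosineSpace.firstCoeff (CosineSpace.profileSq (V p))) p :=
        (CosineSpace.firstCoeff.contDiff.comp CosineSpace.contDiff_profileSq).contDiffAt.comp p
          (hVan p hp).contDiffAt
      have h2 : ContDiffAt ℝ ω (fun p : ℝ × ℝ => γ / p.2 ^ 2 + β * p.2 ^ 2) p :=
        (ContDiffAt.div (g := fun p : ℝ × ℝ => p.2 ^ 2) contDiffAt_const (contDiffAt_snd.pow 2)
          (pow_ne_zero 2 hp.1.1.ne')).add (contDiffAt_const.mul (contDiffAt_snd.pow 2))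
      exact (h2.add (contDiffAt_fst.mul h1)).analyticAt
  refine ⟨Ω, fun a k z => CosineSpace.evalDeriv 0 z (a • (CosineSpace.mode 1 + V (a, k))),
    fun a k => CosineSpace.waveSpeed β γ a k (V (a, k)), hopen, hzero, ?_, ?_, ?_, ?_, hcan, ?_⟩
  · exact fun a k hp => ⟨(hK k).2 hp.1, hp.1, by
      simpa only [hneg, norm_neg] using hp.2⟩
  · intro a k hp
    have hsolves := CosineSpace.solvesProfile_of_fixedPoint hp.1.1 hp.1.2 (hVfix _ hp)
    exact ⟨CosineSpace.contDiff_evalDeriv _, fun z => CosineSpace.evalDeriv_add_two_pi 0 z _,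
      fun z => CosineSpace.evalDeriv_zero_neg z _, hsolves,
      hsolves.solvesOstrovsky (CosineSpace.contDiff_evalDeriv _), hcneg a k hp⟩
  · exact fun k hk => ⟨fun z => by simp, by simp [CosineSpace.waveSpeed]⟩
  · refine fun j => ⟨fun p => CosineSpace.toCircleMap j (p.1 • (CosineSpace.mode 1 + V p)), ?_, ?_⟩
    · intro p hp
      have h1 : ContDiffAt ℝ ω (fun p : ℝ × ℝ => p.1 • (CosineSpace.mode 1 + V p)) p :=
        contDiffAt_fst.smul (contDiffAt_const.add (hVan p hp).contDiffAt)
      exact ((CosineSpace.toCircleMap j).contDiff.contDiffAt.comp p h1).analyticAt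
    · intro p _ z
      rw [CosineSpace.iteratedDeriv_evalDeriv]
      rfl
  · intro k hk
    have hline : AnalyticAt ℝ (fun a : ℝ => (a, k)) 0 := by fun_prop
    have hmem : ∀ᶠ a : ℝ in 𝓝 0, (a, k) ∈ Ω :=
      hline.continuousAt.eventually_mem (hopen.mem_nhds (hzero k hk))
    have hcont : ContinuousAt (fun a : ℝ => V (a, k)) 0 :=
      (AnalyticAt.comp (g := V) (f := fun a : ℝ => (a, k)) (hVan _ (hzero k hk)) hline).continuousAt
    have hO := CosineSpace.isBigO_sub_stokesApprox ((hK k).1 hk).2 hcont (hV0 k)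
      (hmem.mono fun a ha => hVfix _ ha)
    refine ⟨fun j => ?_, ?_⟩
    · obtain ⟨C, hC⟩ := hO.bound
      refine ⟨‖CosineSpace.toCircleMap j‖ * C, hC.mono fun a ha z => ?_⟩
      -- The remainder is itself a cosine series, so one norm bound controls every derivative
      -- uniformly in z.
      simp only [← CosineSpace.evalDeriv_stokesApprox, ← map_sub, ← smul_sub, add_sub_add_left_eq_sub]
      rw [CosineSpace.iteratedDeriv_evalDeriv]
      refine (CosineSpace.abs_evalDeriv_le j z _).trans ?_
      rw [norm_smul, norm_eq_abs, mul_assoc]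
      rw [norm_pow, norm_eq_abs] at ha
      refine mul_le_mul_of_nonneg_left ?_ (CosineSpace.toCircleMap j).opNorm_nonneg
      calc _ ≤ |a| * (C * |a| ^ 4) := by gcongr
        _ = C * |a| ^ 5 := by ring
    · have hexp : AnalyticAt ℝ (speedExpansion β γ k) 0 := by
        unfold speedExpansion
        fun_prop
      -- The direct estimate gives only O(a⁵); parity supplies the last power.
      refine AnalyticAt.isBigO_pow_succ_of_even
        ((AnalyticAt.comp (f := fun a : ℝ => (a, k)) (hcan _ (hzero k hk)) hline).sub hexp)
        (hmem.mono fun a ha => ?_) (by decide)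
        (CosineSpace.isBigO_waveSpeed_sub hcont (hV0 k) hO)
      simp only [Pi.sub_apply, Function.comp_apply, hcneg a k ha, speedExpansion]
      ring
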